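/- Let $d\ge 1$ and let $\Omega$ be the unit sphere of $\mathbb C^d$ with its unitarily invariant probability measure $\omega$. Let $\mathrm{Hom}(k,l)$ be the space of complex polynomials in $z_1,\dots,z_d,\bar z_1,\dots,\bar z_d$ that are homogeneous of degree $k$ in the $z_i$ and homogeneous of degree $l$ in the $\bar z_i$. For an integer $t\ge 0$, a finite set $X\subset\Omega$ is a (complex) $t$-design if $$\frac1{|X|}\sum_{z\in X}f(z)=\int_\Omega f(z)\,d\omega(z)\qquad\text{for every } f\in\mathrm{Hom}(t,t).$$ The degree set of $X$ is $\{|x^*y|^2 : x,y\in X,\ x\ne y\}$. For $k\ge 0$ let $$h_k(x)=\frac{d+2k}{(d-1)!}\sum_{r=0}^k(-1)^r\frac{(d+2k-r-1)!}{r!\,(k-r+1)!\,(k-r)!}\,x^{k-r}$$ be the Jacobi polynomials for $\mathrm{Hom}(k+1,k)$. **Theorem.** Let $X\subset\Omega$ be a $t$-design, and let $F\in\mathbb R[x]$ be a polynomial such that (a) $\alpha F(\alpha)\ge 0$ for every $\alpha$ in the degree set of $X$, and $F(1)>0$; (b) in the (finite) expansion $F=\sum_r c_r h_r$ with real coefficients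 $c_r$, one has $c_0>0$ and $c_r\le 0$ for all $r\ge t$. Then $|X|\ge F(1)/c_0$. -/

import Mathlib

open MeasureTheory Polynomial

noncomputable section

namespace ComplexDesign

/-- The unit sphere `Ω` in `ℂ^d`. -/
abbrev Omega (d : ℕ) : Type := Metric.sphere (0 : EuclideanSpace ℂ (Fin d)) 1

/-- The rotation invariant measure `ω` on the unit sphere of `ℂ^d`, with total mass `1` (for
`d ≥ 1`): the surface measure induced by Lebesgue measure, divided by its total mass. -/
def omega (d : ℕ) : Measure (Omega d) :=
  ((volume : Measure (EuclideanSpace ℂ (Fin d))).toSphere Set.univ)⁻¹ •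
    (volume : Measure (EuclideanSpace ℂ (Fin d))).toSphere

/-- `Hom(k,l)`: polynomials over `ℂ` in the variables `z_1, …, z_d` (indices `Sum.inl i`) and
`z̄_1, …, z̄_d` (indices `Sum.inr i`) that are homogeneous of degree `k` in the `z_i` and
homogeneous of degree `l` in the `z̄_i`. -/
def Hom (d k l : ℕ) : Submodule ℂ (MvPolynomial (Fin d ⊕ Fin d) ℂ) :=
  MvPolynomial.weightedHomogeneousSubmodule ℂ (Sum.elim (fun _ => 1) (fun _ => 0)) k ⊓
    MvPolynomial.weightedHomogeneousSubmodule ℂ (Sum.elim (fun _ => 0) (fun _ => 1)) l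

/-- The value `f(z_1, …, z_d; z̄_1, …, z̄_d)` at a point `z` of `ℂ^d`. -/
def evalAt {d : ℕ} (f : MvPolynomial (Fin d ⊕ Fin d) ℂ) (z : EuclideanSpace ℂ (Fin d)) : ℂ :=
  MvPolynomial.eval (Sum.elim (fun i => z i) (fun i => starRingEnd ℂ (z i))) f

/-- A finite subset `X` of `Ω` is a (complex) `t`-design if for every `f ∈ Hom(t,t)` the average of
`f` over `X` is the average of `f` over `Ω`. -/
def IsDesign {d : ℕ} (t : ℕ) (X : Finset (Omega d)) : Prop :=
  ∀ f ∈ Hom d t t,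
    (1 / (X.card : ℂ)) * ∑ z ∈ X, evalAt f (z : EuclideanSpace ℂ (Fin d)) =
      ∫ z : Omega d, evalAt f (z : EuclideanSpace ℂ (Fin d)) ∂(omega d)

/-- The degree set of `X`: the set of all `|x^* y|²` with `x ≠ y` in `X`. -/
def degreeSet {d : ℕ} (X : Finset (Omega d)) : Set ℝ :=
  {α | ∃ x ∈ X, ∃ y ∈ X, x ≠ y ∧
    ‖inner ℂ (x : EuclideanSpace ℂ (Fin d)) (y : EuclideanSpace ℂ (Fin d))‖ ^ 2 = α}

/-- The Jacobi polynomial `h_k` for `Harm(k+1,k)` on `ℂ^d` (`d ≥ 1`):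
`h_k(x) = (d+2k)/(d-1)! * ∑_{r=0}^k (-1)^r (d+2k-r-1)! / (r! (k-r+1)! (k-r)!) x^(k-r)`. -/
def jacobiH (d k : ℕ) : ℝ[X] :=
  C (((d : ℝ) + 2 * k) / (Nat.factorial (d - 1) : ℝ)) *
    ∑ r ∈ Finset.range (k + 1),
      C ((-1 : ℝ) ^ r * (Nat.factorial (d + 2 * k - r - 1) : ℝ) /
        ((Nat.factorial r : ℝ) * (Nat.factorial (k - r + 1) : ℝ) *
          (Nat.factorial (k - r) : ℝ))) * X ^ (k - r)

end ComplexDesign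

end

noncomputable section
namespace ComplexDesign

/-! Linear programming. Put `T p = ∑ x, y ∈ X, α * p(α)` with `α = |x^* y|²` and estimate `T F`
twice. All terms are non-negative by (a), so the diagonal alone gives `T F ≥ |X| F(1)`. Expanding in
the `h_r`, one has `T h_0 = |X|²`, `T h_r = 0` for `1 ≤ r < t`, and `T h_r ≥ 0` always, so (b) gives
`T F ≤ c_0 |X|²`.

Positivity (`sum_mul_eval_jacobiH_nonneg`): for the Fischer product, multiplication by `z^* z` is
adjoint to the Laplacian and `(x^* z)^k (z^* x)^l` reproduces values at `x`. Hence the harmonic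
zonal polynomials have Gram matrix `conj(Z_y(x))` up to a positive factor (`fischer_zonal_zonal`).
Up to positive scaling, `α h_k(α)` is the Schur product of this matrix with a Gram matrix of the
points.

Vanishing (`sum_mul_eval_jacobiH_eq_zero`): a design has the moments of the sphere up to order `t`.
These come from Gaussian integrals (`integral_omega_norm_inner_pow`), and their pairing with `α
h_k(α)` is a `k`-th difference of a polynomial of degree `k - 1`. -/

/-! ### Moments of the sphere from Gaussian integrals -/

open Set Metric Measure in
/-- Gaussian integrals of functions homogeneous of degree `n`, in polar coordinates. -/
theorem integral_homogeneous_mul_exp_neg_sq {E : Type*} [NormedAddCommGroup E] [NormedSpace ℝ E]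
    [MeasurableSpace E] [BorelSpace E] [Nontrivial E] [FiniteDimensional ℝ E]
    (μ : Measure E) [μ.IsAddHaarMeasure] (n : ℕ) (g : E → ℝ)
    (hg : ∀ (r : ℝ) (x : E), 0 < r → g (r • x) = r ^ n * g x) :
    ∫ x, g x * Real.exp (-‖x‖ ^ 2) ∂μ =
      (∫ x : sphere (0 : E) 1, g x ∂μ.toSphere) *
        (Real.Gamma ((Module.finrank ℝ E + n) / 2) / 2) := by
  have hD : 0 < Module.finrank ℝ E := Module.finrank_pos
  calc
    ∫ x, g x * Real.exp (-‖x‖ ^ 2) ∂μ =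
        ∫ x : ({(0)}ᶜ : Set E), g x.1 * Real.exp (-‖x.1‖ ^ 2) ∂(μ.comap (↑)) := by
      rw [integral_subtype_comap (measurableSet_singleton _).compl
        fun x ↦ g x * Real.exp (-‖x‖ ^ 2), restrict_compl_singleton]
    _ = ∫ x : sphere (0 : E) 1 × Ioi (0 : ℝ),
          g x.1 * ((x.2 : ℝ) ^ n * Real.exp (-(x.2 : ℝ) ^ 2))
          ∂μ.toSphere.prod (.volumeIoiPow (Module.finrank ℝ E - 1)) := by
      rw [← μ.measurePreserving_homeomorphUnitSphereProd.integral_comp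
        (Homeomorph.measurableEmbedding _)]
      refine integral_congr_ae (.of_forall fun x ↦ ?_)
      have hx : 0 < ‖x.1‖ := norm_pos_iff.2 x.2
      have h := hg ‖x.1‖ (‖x.1‖⁻¹ • x.1) hx
      rw [smul_inv_smul₀ hx.ne'] at h
      simp only [homeomorphUnitSphereProd_apply_fst_coe, homeomorphUnitSphereProd_apply_snd_coe]
      rw [h]; ring
    _ = (∫ x : sphere (0 : E) 1, g x ∂μ.toSphere) *
          ∫ r : Ioi (0 : ℝ), (r : ℝ) ^ n * Real.exp (-(r : ℝ) ^ 2)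
            ∂(.volumeIoiPow (Module.finrank ℝ E - 1)) :=
      integral_prod_mul (fun x : sphere (0 : E) 1 ↦ g x)
        fun r : Ioi (0 : ℝ) ↦ (r : ℝ) ^ n * Real.exp (-(r : ℝ) ^ 2)
    _ = _ := by
      congr 1
      have h1 : ∫ r : Ioi (0 : ℝ), (r : ℝ) ^ n * Real.exp (-(r : ℝ) ^ 2)
            ∂(.volumeIoiPow (Module.finrank ℝ E - 1)) =
          ∫ r in Ioi (0 : ℝ), r ^ ((Module.finrank ℝ E - 1 + n : ℕ) : ℝ) *
            Real.exp (-r ^ (2 : ℝ)) := by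
        simp only [Measure.volumeIoiPow, ENNReal.ofReal]
        rw [integral_withDensity_eq_integral_smul, integral_subtype_comap measurableSet_Ioi
          fun a ↦ Real.toNNReal (a ^ (Module.finrank ℝ E - 1)) • (a ^ n * Real.exp (-a ^ 2)),
          setIntegral_congr_fun measurableSet_Ioi fun x hx ↦ ?_]
        · rw [NNReal.smul_def, Real.coe_toNNReal _ (pow_nonneg (le_of_lt hx) _), Real.rpow_natCast,
            smul_eq_mul, pow_add, Real.rpow_two, mul_assoc]
        · exact (measurable_subtype_coe.pow_const _).real_toNNReal
      rw [h1, integral_rpow_mul_exp_neg_rpow two_pos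
        (lt_of_lt_of_le (by norm_num) (Nat.cast_nonneg _))]
      rw [Nat.cast_add, Nat.cast_pred hD]
      ring_nf

theorem integral_complex_norm_pow_mul_exp_neg_sq (k : ℕ) :
    ∫ z : ℂ, ‖z‖ ^ (2 * k) * Real.exp (-‖z‖ ^ 2) = Real.pi * k.factorial := by
  have h := Complex.integral_rpow_mul_exp_neg_rpow (p := 2) (q := ((2 * k : ℕ) : ℝ)) one_le_two
    (lt_of_lt_of_le (by norm_num) (Nat.cast_nonneg _))
  simp only [Real.rpow_natCast, Real.rpow_two] at h
  rw [h, ← Real.Gamma_nat_eq_factorial]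
  push_cast
  ring_nf

/-- By Fubini, only the `i`-th factor depends on `k`. The constant `c` stays unspecified because it
cancels later against the case `k = 0`. -/
theorem exists_integral_coord_norm_pow_mul_exp_neg_sq {d : ℕ} (i : Fin d) :
    ∃ c : ℝ, ∀ k : ℕ, ∫ z : EuclideanSpace ℂ (Fin d), ‖z i‖ ^ (2 * k) * Real.exp (-‖z‖ ^ 2) =
      c * k.factorial := by
  let e : EuclideanSpace ℂ (Fin d) ≃L[ℝ] (Fin d → ℂ) :=
    (PiLp.continuousLinearEquiv 2 ℝ fun _ : Fin d ↦ ℂ)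
  have hH : (Measure.map e volume).IsAddHaarMeasure :=
    e.isAddHaarMeasure_map _
  obtain ⟨c, hc⟩ : ∃ c : ℝ, ∀ f : (Fin d → ℂ) → ℝ,
      ∫ z, f (e z) = c * ∫ z, f z := by
    refine ⟨(Measure.addHaarScalarFactor (Measure.map e volume) volume : ℝ), fun f ↦ ?_⟩
    refine ((e.toHomeomorph.measurableEmbedding).integral_map (μ := volume) f).symm.trans ?_
    have := Measure.isAddLeftInvariant_eq_smul (Measure.map e volume) (volume : Measure (Fin d → ℂ))
    change ∫ y, f y ∂(Measure.map e volume) = _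
    conv_lhs => rw [this]
    rw [integral_smul_nnreal_measure, NNReal.smul_def, smul_eq_mul]
  refine ⟨c * Real.pi ^ d, fun k ↦ ?_⟩
  -- The exponent `0` off `i` puts every factor in the form of the one-variable integral.
  have h := hc fun z ↦ ∏ j, (‖z j‖ ^ (2 * if j = i then k else 0) * Real.exp (-‖z j‖ ^ 2))
  rw [integral_fintype_prod_volume_eq_prod
    (fun j (w : ℂ) ↦ ‖w‖ ^ (2 * if j = i then k else 0) * Real.exp (-‖w‖ ^ 2))] at h
  simp only [integral_complex_norm_pow_mul_exp_neg_sq] at h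
  rw [Finset.prod_mul_distrib] at h
  simp only [Finset.prod_const, Finset.card_univ, Fintype.card_fin] at h
  rw [Finset.prod_eq_single i (by intro j _ hj; simp [hj]) (by simp), if_pos rfl, ← mul_assoc] at h
  rw [← h]
  refine integral_congr_ae (.of_forall fun z ↦ ?_)
  dsimp only
  rw [Finset.prod_mul_distrib, Finset.prod_eq_single i (by intro j _ hj; simp [hj]) (by simp),
    if_pos rfl, ← Real.exp_sum, EuclideanSpace.norm_sq_eq, Finset.sum_neg_distrib]
  rfl

/-- Unitary invariance: in an orthonormal basis starting with `x`, the form `x^* z` is a coordinate.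
-/
theorem exists_integral_inner_norm_pow_mul_exp_neg_sq {d : ℕ} (x : EuclideanSpace ℂ (Fin d))
    (hx : ‖x‖ = 1) :
    ∃ c : ℝ, ∀ k : ℕ, ∫ z : EuclideanSpace ℂ (Fin d),
      ‖inner ℂ x z‖ ^ (2 * k) * Real.exp (-‖z‖ ^ 2) = c * k.factorial := by
  have hd : 0 < d := by
    rcases Nat.eq_zero_or_pos d with rfl | h
    · simp [Subsingleton.elim x 0] at hx
    · exact h
  let i : Fin d := ⟨0, hd⟩
  have ho : Orthonormal ℂ (({i} : Set (Fin d)).domRestrict fun _ ↦ x) :=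
    ⟨fun _ ↦ hx, fun a b hab ↦ (hab (Subsingleton.elim a b)).elim⟩
  obtain ⟨b, hb⟩ := ho.exists_orthonormalBasis_extension_of_card_eq (by simp)
  obtain ⟨c, hc⟩ := exists_integral_coord_norm_pow_mul_exp_neg_sq i
  refine ⟨c, fun k ↦ ?_⟩
  let U : EuclideanSpace ℂ (Fin d) ≃ₗᵢ[ℝ] EuclideanSpace ℂ (Fin d) :=
    { b.repr.toLinearEquiv.restrictScalars ℝ with norm_map' := b.repr.norm_map }
  rw [← hc k, ← U.measurePreserving.integral_comp U.toHomeomorph.measurableEmbedding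
    fun z ↦ ‖z i‖ ^ (2 * k) * Real.exp (-‖z‖ ^ 2)]
  refine integral_congr_ae (.of_forall fun z ↦ ?_)
  have h1 : (U z) i = inner ℂ x z := by
    rw [← hb i rfl]; exact b.repr_apply_apply z i
  dsimp only
  rw [h1, U.norm_map]

/-- The moments of `|x^* z|²` on the unit sphere. -/
theorem integral_omega_norm_inner_pow {d : ℕ} (x : Omega d) (k : ℕ) :
    ∫ z : Omega d, ‖inner ℂ (x : EuclideanSpace ℂ (Fin d)) z‖ ^ (2 * k) ∂(omega d) =
      k.factorial * (d - 1).factorial / (d + k - 1).factorial := by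
  have hx : ‖(x : EuclideanSpace ℂ (Fin d))‖ = 1 := by simp
  have hd : 0 < d := by
    rcases Nat.eq_zero_or_pos d with rfl | h
    · simp [Subsingleton.elim (x : EuclideanSpace ℂ (Fin 0)) 0] at hx
    · exact h
  have : Nonempty (Fin d) := ⟨⟨0, hd⟩⟩
  obtain ⟨c, hc⟩ := exists_integral_inner_norm_pow_mul_exp_neg_sq (x : EuclideanSpace ℂ (Fin d)) hx
  set σ := (volume : Measure (EuclideanSpace ℂ (Fin d))).toSphere
  have hdim : Module.finrank ℝ (EuclideanSpace ℂ (Fin d)) = 2 * d := by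
    rw [finrank_real_of_complex, finrank_euclideanSpace_fin]
  -- The same Gaussian integral in polar coordinates: real dimension `2d` and degree `2k` give `Γ(d
  -- + k) / 2`. The case `k = 0` then eliminates `c` and supplies the total mass.
  have key : ∀ k : ℕ, c * k.factorial =
      (∫ z : Omega d, ‖inner ℂ (x : EuclideanSpace ℂ (Fin d)) z‖ ^ (2 * k) ∂σ) *
        ((d + k - 1).factorial / 2) := by
    intro k
    rw [← hc k, integral_homogeneous_mul_exp_neg_sq volume (2 * k)
      (fun z ↦ ‖inner ℂ (x : EuclideanSpace ℂ (Fin d)) z‖ ^ (2 * k)), hdim,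
      ← Real.Gamma_nat_eq_factorial, Nat.cast_pred (by lia)]
    · push_cast
      rw [← mul_add, mul_div_cancel_left₀ _ (two_ne_zero' ℝ), sub_add_cancel]
    · intro r z hr
      rw [RCLike.real_smul_eq_coe_smul (K := ℂ) r z, inner_smul_right, norm_mul, mul_pow]
      simp [abs_of_pos hr]
  have h0 := key 0
  have hk := key k
  simp only [mul_zero, pow_zero, integral_const, smul_eq_mul, mul_one, Nat.factorial_zero,
    Nat.cast_one, add_zero] at h0
  have hσ : σ Set.univ ≠ 0 := by
    rw [Ne, Measure.measure_univ_eq_zero]; exact Measure.toSphere_ne_zero _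
  have hσ' : σ.real Set.univ ≠ 0 := by
    rw [Measure.real, ENNReal.toReal_ne_zero]; exact ⟨hσ, measure_ne_top _ _⟩
  have h1 : ((d + k - 1).factorial : ℝ) ≠ 0 := by positivity
  rw [omega, integral_smul_measure, ENNReal.toReal_inv, smul_eq_mul]
  change (σ.real Set.univ)⁻¹ * _ = _
  rw [h0] at hk
  field_simp
  linarith

/-! ### The Fischer inner product -/

section Fischer

variable {σ : Type*} [Fintype σ]

/-- The Fischer inner product on polynomials, linear in the first variable: monomials are
orthogonal, and `X^m` has square norm `m!`. -/
def fischer (p q : MvPolynomial σ ℂ) : ℂ :=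
  ∑ m ∈ p.support, (∏ i, ((m i).factorial : ℂ)) * p.coeff m * starRingEnd ℂ (q.coeff m)

theorem fischer_eq_sum {p : MvPolynomial σ ℂ} {s : Finset (σ →₀ ℕ)} (hs : p.support ⊆ s)
    (q : MvPolynomial σ ℂ) : fischer p q =
      ∑ m ∈ s, (∏ i, ((m i).factorial : ℂ)) * p.coeff m * starRingEnd ℂ (q.coeff m) :=
  Finset.sum_subset hs fun m _ hm ↦ by rw [MvPolynomial.notMem_support_iff.1 hm]; ring

theorem fischer_add_left (p p' q : MvPolynomial σ ℂ) :
    fischer (p + p') q = fischer p q + fischer p' q := by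
  classical
  rw [fischer_eq_sum MvPolynomial.support_add, fischer_eq_sum (s := p.support ∪ p'.support)
    Finset.subset_union_left, fischer_eq_sum (s := p.support ∪ p'.support)
    Finset.subset_union_right, ← Finset.sum_add_distrib]
  refine Finset.sum_congr rfl fun m _ ↦ ?_
  rw [MvPolynomial.coeff_add]
  ring

theorem fischer_monomial_left (m : σ →₀ ℕ) (a : ℂ) (q : MvPolynomial σ ℂ) :
    fischer (MvPolynomial.monomial m a) q =
      (∏ i, ((m i).factorial : ℂ)) * a * starRingEnd ℂ (q.coeff m) := by
  classical
  rw [fischer_eq_sum MvPolynomial.support_monomial_subset, Finset.sum_singleton,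
    MvPolynomial.coeff_monomial, if_pos rfl]

theorem fischer_smul_left (a : ℂ) (p q : MvPolynomial σ ℂ) :
    fischer (a • p) q = a * fischer p q := by
  induction p using MvPolynomial.induction_on' with
  | monomial m b =>
    rw [MvPolynomial.smul_monomial, fischer_monomial_left, fischer_monomial_left, smul_eq_mul]
    ring
  | add p p' hp hp' => rw [smul_add, fischer_add_left, fischer_add_left, hp, hp', mul_add]

theorem fischer_add_right (p q q' : MvPolynomial σ ℂ) :
    fischer p (q + q') = fischer p q + fischer p q' := by
  unfold fischer
  rw [← Finset.sum_add_distrib]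
  refine Finset.sum_congr rfl fun m _ ↦ ?_
  rw [MvPolynomial.coeff_add, map_add, mul_add]

theorem fischer_smul_right (a : ℂ) (p q : MvPolynomial σ ℂ) :
    fischer p (a • q) = starRingEnd ℂ a * fischer p q := by
  unfold fischer
  rw [Finset.mul_sum]
  refine Finset.sum_congr rfl fun m _ ↦ ?_
  rw [MvPolynomial.coeff_smul, smul_eq_mul, map_mul]
  ring

theorem fischer_sum_left {ι : Type*} (s : Finset ι) (f : ι → MvPolynomial σ ℂ)
    (q : MvPolynomial σ ℂ) : fischer (∑ i ∈ s, f i) q = ∑ i ∈ s, fischer (f i) q :=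
  map_sum (AddMonoidHom.mk' (fun p ↦ fischer p q) fun p p' ↦ fischer_add_left p p' q) f s

theorem fischer_sum_right {ι : Type*} (s : Finset ι) (f : ι → MvPolynomial σ ℂ)
    (p : MvPolynomial σ ℂ) : fischer p (∑ i ∈ s, f i) = ∑ i ∈ s, fischer p (f i) :=
  map_sum (AddMonoidHom.mk' (fun q ↦ fischer p q) fun q q' ↦ fischer_add_right p q q') f s

theorem fischer_self_re_nonneg (p : MvPolynomial σ ℂ) : 0 ≤ (fischer p p).re := by
  unfold fischer
  rw [Complex.re_sum]
  refine Finset.sum_nonneg fun m _ ↦ ?_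
  have h : p.coeff m * starRingEnd ℂ (p.coeff m) = ((Complex.normSq (p.coeff m) : ℝ) : ℂ) :=
    Complex.mul_conj _
  rw [mul_assoc, h, ← Nat.cast_prod, ← Complex.ofReal_natCast, ← Complex.ofReal_mul,
    Complex.ofReal_re]
  exact mul_nonneg (Nat.cast_nonneg _) (Complex.normSq_nonneg _)

/-- Multiplication by a variable is adjoint to the corresponding partial derivative. -/
theorem fischer_X_mul_left (i : σ) (p q : MvPolynomial σ ℂ) :
    fischer (MvPolynomial.X i * p) q = fischer p (MvPolynomial.pderiv i q) := by
  classical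
  induction p using MvPolynomial.induction_on' with
  | monomial m a =>
    rw [mul_comm, MvPolynomial.X, MvPolynomial.monomial_mul, mul_one, fischer_monomial_left,
      fischer_monomial_left, MvPolynomial.coeff_pderiv]
    have h : (∏ j, (((m + Finsupp.single i 1 : σ →₀ ℕ) j).factorial : ℂ)) =
        (∏ j, ((m j).factorial : ℂ)) * (m i + 1) := by
      rw [← Finset.mul_prod_erase _ _ (Finset.mem_univ i),
        ← Finset.mul_prod_erase Finset.univ (fun j ↦ ((m j).factorial : ℂ)) (Finset.mem_univ i)]
      have h' : ∀ j ∈ Finset.univ.erase i, (((m + Finsupp.single i 1 : σ →₀ ℕ) j).factorial : ℂ) =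
          ((m j).factorial : ℂ) := by
        intro j hj
        simp [(Finset.ne_of_mem_erase hj).symm]
      rw [Finset.prod_congr rfl h', Finsupp.add_apply, Finsupp.single_eq_same,
        Nat.factorial_succ]
      push_cast
      ring
    rw [h]
    simp
    ring
  | add p p' hp hp' => rw [mul_add, fischer_add_left, fischer_add_left, hp, hp']

end Fischer

/-! ### Bihomogeneous forms and the reproducing property -/

section Polys

variable {d : ℕ}

/-- The variable `z_i`. -/
abbrev Zvar (i : Fin d) : MvPolynomial (Fin d ⊕ Fin d) ℂ := MvPolynomial.X (Sum.inl i)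

/-- The variable `z̄_i`. -/
abbrev Wvar (i : Fin d) : MvPolynomial (Fin d ⊕ Fin d) ℂ := MvPolynomial.X (Sum.inr i)

/-- The form `z ↦ x^* z`. -/
def linForm (x : EuclideanSpace ℂ (Fin d)) : MvPolynomial (Fin d ⊕ Fin d) ℂ :=
  ∑ i, starRingEnd ℂ (x i) • Zvar i

/-- The form `z ↦ z^* x`. -/
def conjLinForm (x : EuclideanSpace ℂ (Fin d)) : MvPolynomial (Fin d ⊕ Fin d) ℂ :=
  ∑ i, x i • Wvar i

/-- The form `z ↦ z^* z`. -/
def normForm (d : ℕ) : MvPolynomial (Fin d ⊕ Fin d) ℂ := ∑ i, Zvar i * Wvar i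

theorem evalAt_linForm (x z : EuclideanSpace ℂ (Fin d)) :
    evalAt (linForm x) z = inner ℂ x z := by
  simp [evalAt, linForm, PiLp.inner_apply, MvPolynomial.smul_eval, mul_comm]

theorem evalAt_conjLinForm (x z : EuclideanSpace ℂ (Fin d)) :
    evalAt (conjLinForm x) z = inner ℂ z x := by
  simp [evalAt, conjLinForm, PiLp.inner_apply, MvPolynomial.smul_eval]

theorem evalAt_normForm (z : EuclideanSpace ℂ (Fin d)) (hz : ‖z‖ = 1) :
    evalAt (normForm d) z = 1 := by
  have h := inner_self_eq_norm_sq_to_K (𝕜 := ℂ) z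
  rw [hz, PiLp.inner_apply] at h
  simpa [evalAt, normForm, Complex.mul_conj'] using h

theorem linForm_mem (x : EuclideanSpace ℂ (Fin d)) : linForm x ∈ Hom d 1 0 := by
  refine Submodule.sum_mem _ fun i _ ↦ Submodule.smul_mem _ _ ⟨?_, ?_⟩
  · exact MvPolynomial.isWeightedHomogeneous_X ℂ _ (Sum.inl i)
  · exact MvPolynomial.isWeightedHomogeneous_X ℂ _ (Sum.inl i)

theorem conjLinForm_mem (x : EuclideanSpace ℂ (Fin d)) : conjLinForm x ∈ Hom d 0 1 := by
  refine Submodule.sum_mem _ fun i _ ↦ Submodule.smul_mem _ _ ⟨?_, ?_⟩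
  · exact MvPolynomial.isWeightedHomogeneous_X ℂ _ (Sum.inr i)
  · exact MvPolynomial.isWeightedHomogeneous_X ℂ _ (Sum.inr i)

theorem mul_mem_Hom {k l k' l' : ℕ} {f g : MvPolynomial (Fin d ⊕ Fin d) ℂ} (hf : f ∈ Hom d k l)
    (hg : g ∈ Hom d k' l') : f * g ∈ Hom d (k + k') (l + l') :=
  ⟨MvPolynomial.IsWeightedHomogeneous.mul hf.1 hg.1,
    MvPolynomial.IsWeightedHomogeneous.mul hf.2 hg.2⟩

theorem one_mem_Hom : (1 : MvPolynomial (Fin d ⊕ Fin d) ℂ) ∈ Hom d 0 0 :=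
  ⟨MvPolynomial.isWeightedHomogeneous_one _ _, MvPolynomial.isWeightedHomogeneous_one _ _⟩

theorem normForm_mem : normForm d ∈ Hom d 1 1 := by
  refine Submodule.sum_mem _ fun i _ ↦ ?_
  exact mul_mem_Hom (k := 1) (l := 0) (k' := 0) (l' := 1)
    ⟨MvPolynomial.isWeightedHomogeneous_X ℂ _ (Sum.inl i),
      MvPolynomial.isWeightedHomogeneous_X ℂ _ (Sum.inl i)⟩
    ⟨MvPolynomial.isWeightedHomogeneous_X ℂ _ (Sum.inr i),
      MvPolynomial.isWeightedHomogeneous_X ℂ _ (Sum.inr i)⟩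

theorem pow_mem_Hom {k l : ℕ} {f : MvPolynomial (Fin d ⊕ Fin d) ℂ} (hf : f ∈ Hom d k l) (n : ℕ) :
    f ^ n ∈ Hom d (n * k) (n * l) := by
  induction n with
  | zero => simpa using one_mem_Hom
  | succ n ih => rw [pow_succ, Nat.succ_mul, Nat.succ_mul]; exact mul_mem_Hom ih hf

theorem prod_forms_mem (x : EuclideanSpace ℂ (Fin d)) (p a b : ℕ) :
    normForm d ^ p * linForm x ^ a * conjLinForm x ^ b ∈ Hom d (p + a) (p + b) := by
  have := mul_mem_Hom (mul_mem_Hom (pow_mem_Hom (normForm_mem (d := d)) p)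
    (pow_mem_Hom (linForm_mem x) a)) (pow_mem_Hom (conjLinForm_mem x) b)
  simpa using this

theorem fischer_linForm_mul_left (x : EuclideanSpace ℂ (Fin d))
    (p q : MvPolynomial (Fin d ⊕ Fin d) ℂ) :
    fischer (linForm x * p) q =
      fischer p (∑ i, x i • MvPolynomial.pderiv (Sum.inl i) q) := by
  rw [linForm, Finset.sum_mul, fischer_sum_left, fischer_sum_right]
  refine Finset.sum_congr rfl fun i _ ↦ ?_
  rw [smul_mul_assoc, fischer_smul_left, fischer_smul_right, fischer_X_mul_left]

theorem fischer_conjLinForm_mul_left (x : EuclideanSpace ℂ (Fin d))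
    (p q : MvPolynomial (Fin d ⊕ Fin d) ℂ) :
    fischer (conjLinForm x * p) q =
      fischer p (∑ i, starRingEnd ℂ (x i) • MvPolynomial.pderiv (Sum.inr i) q) := by
  rw [conjLinForm, Finset.sum_mul, fischer_sum_left, fischer_sum_right]
  refine Finset.sum_congr rfl fun i _ ↦ ?_
  rw [smul_mul_assoc, fischer_smul_left, fischer_smul_right, fischer_X_mul_left, Complex.conj_conj]

/-- The Laplace operator `∑ ∂²/∂z_i∂z̄_i`. -/
def laplacian (q : MvPolynomial (Fin d ⊕ Fin d) ℂ) : MvPolynomial (Fin d ⊕ Fin d) ℂ :=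
  ∑ i, MvPolynomial.pderiv (Sum.inl i) (MvPolynomial.pderiv (Sum.inr i) q)

theorem fischer_normForm_mul_left (p q : MvPolynomial (Fin d ⊕ Fin d) ℂ) :
    fischer (normForm d * p) q = fischer p (laplacian q) := by
  rw [normForm, laplacian, Finset.sum_mul, fischer_sum_left, fischer_sum_right]
  refine Finset.sum_congr rfl fun i _ ↦ ?_
  rw [mul_comm (Zvar i), mul_assoc, fischer_X_mul_left, fischer_X_mul_left]

/-- Euler's identity for the weight that counts only the `z_i`. -/
theorem evalAt_sum_pderiv_inl {k l : ℕ} {q : MvPolynomial (Fin d ⊕ Fin d) ℂ} (hq : q ∈ Hom d k l)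
    (x : EuclideanSpace ℂ (Fin d)) :
    evalAt (∑ i, x i • MvPolynomial.pderiv (Sum.inl i) q) x = k * evalAt q x := by
  have h := congrArg (fun f ↦ evalAt f x)
    (MvPolynomial.IsWeightedHomogeneous.sum_weight_X_mul_pderiv hq.1)
  simpa [evalAt, MvPolynomial.smul_eval] using h

theorem evalAt_sum_pderiv_inr {k l : ℕ} {q : MvPolynomial (Fin d ⊕ Fin d) ℂ} (hq : q ∈ Hom d k l)
    (x : EuclideanSpace ℂ (Fin d)) :
    evalAt (∑ i, starRingEnd ℂ (x i) • MvPolynomial.pderiv (Sum.inr i) q) x =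
      l * evalAt q x := by
  have h := congrArg (fun f ↦ evalAt f x)
    (MvPolynomial.IsWeightedHomogeneous.sum_weight_X_mul_pderiv hq.2)
  simpa [evalAt, MvPolynomial.smul_eval] using h

theorem sum_pderiv_inl_mem {k l : ℕ} {q : MvPolynomial (Fin d ⊕ Fin d) ℂ}
    (hq : q ∈ Hom d (k + 1) l) (x : EuclideanSpace ℂ (Fin d)) :
    ∑ i, x i • MvPolynomial.pderiv (Sum.inl i) q ∈ Hom d k l :=
  Submodule.sum_mem _ fun _ _ ↦ Submodule.smul_mem _ _
    ⟨MvPolynomial.IsWeightedHomogeneous.pderiv hq.1 rfl,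
      MvPolynomial.IsWeightedHomogeneous.pderiv hq.2 rfl⟩

theorem sum_pderiv_inr_mem {k l : ℕ} {q : MvPolynomial (Fin d ⊕ Fin d) ℂ}
    (hq : q ∈ Hom d k (l + 1)) (x : EuclideanSpace ℂ (Fin d)) :
    ∑ i, starRingEnd ℂ (x i) • MvPolynomial.pderiv (Sum.inr i) q ∈ Hom d k l :=
  Submodule.sum_mem _ fun _ _ ↦ Submodule.smul_mem _ _
    ⟨MvPolynomial.IsWeightedHomogeneous.pderiv hq.1 rfl,
      MvPolynomial.IsWeightedHomogeneous.pderiv hq.2 rfl⟩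

theorem fischer_one_left_of_mem {q : MvPolynomial (Fin d ⊕ Fin d) ℂ} (hq : q ∈ Hom d 0 0)
    (x : EuclideanSpace ℂ (Fin d)) : fischer 1 q = starRingEnd ℂ (evalAt q x) := by
  have hC : q = MvPolynomial.C (q.coeff 0) := by
    ext m
    rw [MvPolynomial.coeff_C]
    split_ifs with hm
    · rw [hm]
    · by_contra hne
      refine hm (Finsupp.ext fun i ↦ ?_)
      rcases i with i | i
      · have h := hq.1 hne
        rw [Finsupp.weight_apply, Finsupp.sum_fintype _ _ (by simp)] at h
        have := Finset.sum_eq_zero_iff.1 h (Sum.inl i) (Finset.mem_univ _)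
        simpa using this.symm
      · have h := hq.2 hne
        rw [Finsupp.weight_apply, Finsupp.sum_fintype _ _ (by simp)] at h
        have := Finset.sum_eq_zero_iff.1 h (Sum.inr i) (Finset.mem_univ _)
        simpa using this.symm
  have h1 : fischer (1 : MvPolynomial (Fin d ⊕ Fin d) ℂ) q = starRingEnd ℂ (q.coeff 0) := by
    rw [← MvPolynomial.C_1, MvPolynomial.C_apply, fischer_monomial_left]
    simp
  rw [h1, hC]
  simp [evalAt]

/-- The polynomial `(x^* z)^k (z^* x)^l` represents evaluation at `x` on `Hom(k,l)`. -/
theorem fischer_reproducing (x : EuclideanSpace ℂ (Fin d)) (k l : ℕ) :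
    ∀ {q : MvPolynomial (Fin d ⊕ Fin d) ℂ}, q ∈ Hom d k l →
      fischer (linForm x ^ k * conjLinForm x ^ l) q =
        k.factorial * l.factorial * starRingEnd ℂ (evalAt q x) := by
  induction k with
  | zero =>
    induction l with
    | zero => intro q hq; simpa using fischer_one_left_of_mem hq x
    | succ l ih =>
      intro q hq
      -- Each linear factor moves across as a directional derivative along `x`; evaluated at `x`,
      -- Euler's identity turns it into the degree, which builds up the factorials.
      rw [pow_succ', mul_left_comm, fischer_conjLinForm_mul_left, ih (sum_pderiv_inr_mem hq x),
        evalAt_sum_pderiv_inr hq, Nat.factorial_succ]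
      simp
      ring
  | succ k ih =>
    intro q hq
    rw [pow_succ', mul_assoc, fischer_linForm_mul_left, ih (sum_pderiv_inl_mem hq x),
      evalAt_sum_pderiv_inl hq, Nat.factorial_succ]
    simp
    ring

end Polys

/-! ### Zonal harmonics and positivity of the kernel -/

section Laplacian

variable {d : ℕ}

theorem sum_smul_Zvar_eq (x : EuclideanSpace ℂ (Fin d)) :
    ∑ i, MvPolynomial.C (starRingEnd ℂ (x i)) * Zvar i = linForm x := by
  simp [linForm, MvPolynomial.smul_eq_C_mul]

theorem sum_smul_Wvar_eq (x : EuclideanSpace ℂ (Fin d)) :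
    ∑ i, MvPolynomial.C (x i) * Wvar i = conjLinForm x := by
  simp [conjLinForm, MvPolynomial.smul_eq_C_mul]

theorem sum_conj_mul_self (x : EuclideanSpace ℂ (Fin d)) (hx : ‖x‖ = 1) :
    ∑ i, starRingEnd ℂ (x i) * x i = 1 := by
  have h := evalAt_normForm x hx
  simpa [evalAt, normForm, mul_comm] using h

theorem pderiv_inr_normForm (i : Fin d) :
    MvPolynomial.pderiv (Sum.inr i) (normForm d) = Zvar i := by
  simp [normForm, MvPolynomial.pderiv_X, Pi.single_apply]

theorem pderiv_inl_normForm (i : Fin d) :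
    MvPolynomial.pderiv (Sum.inl i) (normForm d) = Wvar i := by
  simp [normForm, MvPolynomial.pderiv_X, Pi.single_apply]

theorem pderiv_inr_linForm (x : EuclideanSpace ℂ (Fin d)) (i : Fin d) :
    MvPolynomial.pderiv (Sum.inr i) (linForm x) = 0 := by
  simp [linForm, MvPolynomial.pderiv_X]

theorem pderiv_inl_linForm (x : EuclideanSpace ℂ (Fin d)) (i : Fin d) :
    MvPolynomial.pderiv (Sum.inl i) (linForm x) = MvPolynomial.C (starRingEnd ℂ (x i)) := by
  simp [linForm, MvPolynomial.pderiv_X, Pi.single_apply, MvPolynomial.smul_eq_C_mul]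

theorem pderiv_inr_conjLinForm (x : EuclideanSpace ℂ (Fin d)) (i : Fin d) :
    MvPolynomial.pderiv (Sum.inr i) (conjLinForm x) = MvPolynomial.C (x i) := by
  simp [conjLinForm, MvPolynomial.pderiv_X, Pi.single_apply, MvPolynomial.smul_eq_C_mul]

theorem pderiv_inl_conjLinForm (x : EuclideanSpace ℂ (Fin d)) (i : Fin d) :
    MvPolynomial.pderiv (Sum.inl i) (conjLinForm x) = 0 := by
  simp [conjLinForm, MvPolynomial.pderiv_X]

/-- The terms are grouped so that all dependence on `i` sits in the last factor, ready for summation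
over `i`. Where a truncated exponent occurs, its coefficient is zero. -/
theorem pderiv_inl_pderiv_inr_forms (x : EuclideanSpace ℂ (Fin d)) (i : Fin d) (p a b : ℕ) :
    MvPolynomial.pderiv (Sum.inl i) (MvPolynomial.pderiv (Sum.inr i)
      (normForm d ^ p * linForm x ^ a * conjLinForm x ^ b)) =
    (((p * (p - 1) : ℕ) : MvPolynomial (Fin d ⊕ Fin d) ℂ) * normForm d ^ (p - 1 - 1) * linForm x ^ a * conjLinForm x ^ b) *
        (Zvar i * Wvar i) +
      (p : MvPolynomial (Fin d ⊕ Fin d) ℂ) * normForm d ^ (p - 1) * linForm x ^ a * conjLinForm x ^ b +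
      (((p * a : ℕ) : MvPolynomial (Fin d ⊕ Fin d) ℂ) * normForm d ^ (p - 1) * linForm x ^ (a - 1) * conjLinForm x ^ b) *
        (MvPolynomial.C (starRingEnd ℂ (x i)) * Zvar i) +
      (((b * p : ℕ) : MvPolynomial (Fin d ⊕ Fin d) ℂ) * normForm d ^ (p - 1) * linForm x ^ a * conjLinForm x ^ (b - 1)) *
        (MvPolynomial.C (x i) * Wvar i) +
      (((a * b : ℕ) : MvPolynomial (Fin d ⊕ Fin d) ℂ) * normForm d ^ p * linForm x ^ (a - 1) * conjLinForm x ^ (b - 1)) *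
        MvPolynomial.C (starRingEnd ℂ (x i) * x i) := by
  have hZ : MvPolynomial.pderiv (Sum.inl i) (Zvar i) = 1 := MvPolynomial.pderiv_X_self _
  have hC : ∀ (j : Fin d ⊕ Fin d) (n : ℕ),
      MvPolynomial.pderiv j (n : MvPolynomial (Fin d ⊕ Fin d) ℂ) = 0 :=
    fun j n ↦ (MvPolynomial.pderiv j).map_natCast n
  simp only [MvPolynomial.pderiv_mul, MvPolynomial.pderiv_pow, map_add, pderiv_inr_normForm,
    pderiv_inl_normForm, pderiv_inr_linForm, pderiv_inl_linForm, pderiv_inr_conjLinForm,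
    pderiv_inl_conjLinForm, MvPolynomial.pderiv_C, hZ, hC, mul_zero, zero_mul, add_zero, zero_add,
    MvPolynomial.C_mul, Nat.cast_mul]
  ring

theorem laplacian_forms (x : EuclideanSpace ℂ (Fin d)) (hx : ‖x‖ = 1) (p a b : ℕ) :
    laplacian (normForm d ^ p * linForm x ^ a * conjLinForm x ^ b) =
      ((p * (p - 1 : ℕ) + p * (d + a + b) : ℕ) : ℂ) •
        (normForm d ^ (p - 1) * linForm x ^ a * conjLinForm x ^ b) +
      ((a * b : ℕ) : ℂ) •
        (normForm d ^ p * linForm x ^ (a - 1) * conjLinForm x ^ (b - 1)) := by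
  have hN : ∑ i : Fin d, Zvar i * Wvar i = normForm d := rfl
  simp only [laplacian, pderiv_inl_pderiv_inr_forms, Finset.sum_add_distrib, ← Finset.mul_sum]
  rw [hN, sum_smul_Zvar_eq, sum_smul_Wvar_eq, ← map_sum, sum_conj_mul_self x hx]
  simp only [MvPolynomial.smul_eq_C_mul, map_natCast, Finset.sum_const, Finset.card_univ,
    Fintype.card_fin, nsmul_eq_mul, map_one, mul_one]
  rcases p with _ | _ | p <;> rcases a with _ | a <;> rcases b with _ | b <;>
    simp <;> ring

/-- The coefficient of `x^(k-r)` in `h_k`, up to the factor `(d+2k)/(d-1)!`. -/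
def jacobiCoeff (d k r : ℕ) : ℝ :=
  (-1 : ℝ) ^ r * ((d + 2 * k - r - 1).factorial : ℝ) /
    ((r.factorial : ℝ) * ((k - r + 1).factorial : ℝ) * ((k - r).factorial : ℝ))

/-- This recursion is exactly harmonicity: it compares the two contributions to one monomial in the
forms. -/
theorem jacobiCoeff_succ (hd : 1 ≤ d) {k r : ℕ} (hr : r < k) :
    jacobiCoeff d k (r + 1) * (((r + 1) * r + (r + 1) * (d + (k - r) + (k - r - 1)) : ℕ) : ℝ) +
      jacobiCoeff d k r * (((k - r + 1) * (k - r) : ℕ) : ℝ) = 0 := by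
  obtain ⟨s, rfl⟩ : ∃ s, k = r + s + 1 := ⟨k - r - 1, by lia⟩
  obtain ⟨e, rfl⟩ : ∃ e, d = e + 1 := ⟨d - 1, by lia⟩
  have h1 : e + 1 + 2 * (r + s + 1) - (r + 1) - 1 = e + r + 2 * s + 1 := by lia
  have h2 : e + 1 + 2 * (r + s + 1) - r - 1 = e + r + 2 * s + 1 + 1 := by lia
  have h3 : r + s + 1 - (r + 1) = s := by lia
  have h4 : r + s + 1 - r = s + 1 := by lia
  simp only [jacobiCoeff, h1, h2, h3, h4, add_tsub_cancel_right, Nat.factorial_succ]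
  push_cast
  field_simp
  ring

/-- The zonal harmonic polynomial in `Hom(k+1,k)` with pole `x`. -/
def zonal (k : ℕ) (x : EuclideanSpace ℂ (Fin d)) : MvPolynomial (Fin d ⊕ Fin d) ℂ :=
  ∑ r ∈ Finset.range (k + 1), (jacobiCoeff d k r : ℂ) •
    (normForm d ^ r * linForm x ^ (k - r + 1) * conjLinForm x ^ (k - r))

theorem zonal_mem (k : ℕ) (x : EuclideanSpace ℂ (Fin d)) : zonal k x ∈ Hom d (k + 1) k := by
  refine Submodule.sum_mem _ fun r hr ↦ Submodule.smul_mem _ _ ?_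
  have h := prod_forms_mem x r (k - r + 1) (k - r)
  have hr' := Finset.mem_range.1 hr
  rwa [show r + (k - r + 1) = k + 1 by lia, show r + (k - r) = k by lia] at h

theorem laplacian_smul (a : ℂ) (q : MvPolynomial (Fin d ⊕ Fin d) ℂ) :
    laplacian (a • q) = a • laplacian q := by
  simp [laplacian, Finset.smul_sum]

theorem laplacian_sum {ι : Type*} (s : Finset ι) (f : ι → MvPolynomial (Fin d ⊕ Fin d) ℂ) :
    laplacian (∑ i ∈ s, f i) = ∑ i ∈ s, laplacian (f i) := by
  simp only [laplacian, map_sum]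
  exact Finset.sum_comm

theorem laplacian_zonal (hd : 1 ≤ d) (k : ℕ) (x : EuclideanSpace ℂ (Fin d)) (hx : ‖x‖ = 1) :
    laplacian (zonal k x) = 0 := by
  simp only [zonal, laplacian_sum, laplacian_smul, laplacian_forms x hx, smul_add,
    Finset.sum_add_distrib]
  -- The boundary terms, `r = 0` of the first sum and `r = k` of the second, have coefficient zero;
  -- the rest cancel in pairs after the shift.
  rw [Finset.sum_range_succ', Finset.sum_range_succ (fun r ↦ (jacobiCoeff d k r : ℂ) •
    ((((k - r + 1) * (k - r) : ℕ) : ℂ) • _))]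
  simp only [zero_mul, add_zero, Nat.cast_zero, zero_smul, smul_zero, tsub_self, mul_zero]
  rw [← Finset.sum_add_distrib]
  refine Finset.sum_eq_zero fun r hr ↦ ?_
  have hr' := Finset.mem_range.1 hr
  have h1 : k - (r + 1) + 1 = k - r := by lia
  have h2 : k - (r + 1) = k - r - 1 := by lia
  rw [h1, h2, add_tsub_cancel_right, add_tsub_cancel_right, smul_smul, smul_smul, ← add_smul]
  have h := congrArg (fun y : ℝ ↦ (y : ℂ)) (jacobiCoeff_succ hd hr')
  simp only [Complex.ofReal_add, Complex.ofReal_mul, Complex.ofReal_natCast,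
    Complex.ofReal_zero] at h
  rw [h, zero_smul]

/-- Terms with `r ≥ 1` contain `normForm d`, whose adjoint kills the harmonic `zonal k y`. The term
`r = 0` reproduces the value at `x`. -/
theorem fischer_zonal_zonal (hd : 1 ≤ d) (k : ℕ) (x y : EuclideanSpace ℂ (Fin d)) (hy : ‖y‖ = 1) :
    fischer (zonal k x) (zonal k y) =
      ((d + 2 * k - 1).factorial : ℂ) * starRingEnd ℂ (evalAt (zonal k y) x) := by
  conv_lhs => rw [zonal, fischer_sum_left, Finset.sum_range_succ']
  rw [Finset.sum_eq_zero, zero_add, fischer_smul_left, pow_zero, one_mul, tsub_zero,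
    fischer_reproducing x _ _ (zonal_mem k y), jacobiCoeff]
  · have h1 : (k.factorial : ℂ) ≠ 0 := by exact_mod_cast k.factorial_ne_zero
    have h2 : ((k + 1).factorial : ℂ) ≠ 0 := by exact_mod_cast (k + 1).factorial_ne_zero
    simp
    field_simp
  · intro r _
    rw [fischer_smul_left, pow_succ', mul_assoc, mul_assoc, fischer_normForm_mul_left,
      laplacian_zonal hd k y hy]
    simp [fischer]

theorem evalAt_zonal (k : ℕ) (x y : EuclideanSpace ℂ (Fin d)) (hx : ‖x‖ = 1) :
    evalAt (zonal k y) x = inner ℂ y x * ((∑ r ∈ Finset.range (k + 1),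
      jacobiCoeff d k r * (‖inner ℂ x y‖ ^ 2) ^ (k - r) : ℝ) : ℂ) := by
  have hN := evalAt_normForm x hx
  have hl := evalAt_linForm y x
  have hm := evalAt_conjLinForm y x
  have hxy : (inner ℂ y x : ℂ) * inner ℂ x y = ((‖inner ℂ x y‖ ^ 2 : ℝ) : ℂ) := by
    rw [← inner_conj_symm y x, Complex.conj_mul', Complex.ofReal_pow]
  unfold evalAt at hN hl hm ⊢
  simp only [zonal, map_sum, MvPolynomial.smul_eval, map_mul, map_pow, hN, hl, hm, one_pow,
    one_mul, Complex.ofReal_sum, Complex.ofReal_mul, Complex.ofReal_pow, Finset.mul_sum]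
  refine Finset.sum_congr rfl fun r _ ↦ ?_
  rw [← Complex.ofReal_pow, ← hxy]
  ring

theorem eval_jacobiH (k : ℕ) (a : ℝ) :
    (jacobiH d k).eval a = ((d : ℝ) + 2 * k) / (d - 1).factorial *
      ∑ r ∈ Finset.range (k + 1), jacobiCoeff d k r * a ^ (k - r) := by
  simp [jacobiH, jacobiCoeff, eval_finsetSum]

/-- The kernel `α h_k(α)`, `α = |x^* y|²`, has non-negative sum over every finite set. -/
theorem sum_mul_eval_jacobiH_nonneg (hd : 1 ≤ d) (k : ℕ) (X : Finset (Omega d)) :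
    0 ≤ ∑ x ∈ X, ∑ y ∈ X, ‖inner ℂ (x : EuclideanSpace ℂ (Fin d)) y‖ ^ 2 *
      (jacobiH d k).eval (‖inner ℂ (x : EuclideanSpace ℂ (Fin d)) y‖ ^ 2) := by
  set S : ℝ → ℝ := fun a ↦ ∑ r ∈ Finset.range (k + 1), jacobiCoeff d k r * a ^ (k - r)
  -- The Schur product argument by hand: each expression is the Fischer square norm of `∑ x_i Z_x`.
  -- Summing over `i` produces the factor `conj(x^* y)`, which turns `x^* y` into `α`.
  have key : ∀ i : Fin d, 0 ≤ (∑ x ∈ X, ∑ y ∈ X, (x : EuclideanSpace ℂ (Fin d)) i *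
      starRingEnd ℂ ((y : EuclideanSpace ℂ (Fin d)) i) * (((d + 2 * k - 1).factorial : ℂ) *
        (inner ℂ (x : EuclideanSpace ℂ (Fin d)) y *
          (S (‖inner ℂ (x : EuclideanSpace ℂ (Fin d)) y‖ ^ 2) : ℂ)))).re := by
    intro i
    refine (fischer_self_re_nonneg (∑ x ∈ X, (x : EuclideanSpace ℂ (Fin d)) i •
      zonal k (x : EuclideanSpace ℂ (Fin d)))).trans_eq ?_
    rw [fischer_sum_left]
    congr 1
    refine Finset.sum_congr rfl fun x _ ↦ ?_
    rw [fischer_sum_right]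
    refine Finset.sum_congr rfl fun y _ ↦ ?_
    rw [fischer_smul_left, fischer_smul_right, fischer_zonal_zonal hd k _ _ (by simp),
      evalAt_zonal k _ _ (by simp), map_mul, Complex.conj_ofReal, inner_conj_symm]
    ring
  have h := Finset.sum_nonneg fun i (_ : i ∈ Finset.univ) ↦ key i
  rw [← Complex.re_sum, Finset.sum_comm] at h
  have h2 : ∑ x ∈ X, ∑ i, ∑ y ∈ X, (x : EuclideanSpace ℂ (Fin d)) i *
      starRingEnd ℂ ((y : EuclideanSpace ℂ (Fin d)) i) * (((d + 2 * k - 1).factorial : ℂ) *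
        (inner ℂ (x : EuclideanSpace ℂ (Fin d)) y *
          (S (‖inner ℂ (x : EuclideanSpace ℂ (Fin d)) y‖ ^ 2) : ℂ))) =
      (((d + 2 * k - 1).factorial * ∑ x ∈ X, ∑ y ∈ X,
        ‖inner ℂ (x : EuclideanSpace ℂ (Fin d)) y‖ ^ 2 *
        S (‖inner ℂ (x : EuclideanSpace ℂ (Fin d)) y‖ ^ 2) : ℝ) : ℂ) := by
    push_cast
    rw [Finset.mul_sum]
    refine Finset.sum_congr rfl fun x _ ↦ ?_
    rw [Finset.sum_comm, Finset.mul_sum]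
    refine Finset.sum_congr rfl fun y _ ↦ ?_
    rw [← Finset.sum_mul]
    have h3 : ∑ i, (x : EuclideanSpace ℂ (Fin d)) i *
        starRingEnd ℂ ((y : EuclideanSpace ℂ (Fin d)) i) =
        starRingEnd ℂ (inner ℂ (x : EuclideanSpace ℂ (Fin d)) y) := by
      rw [inner_conj_symm, PiLp.inner_apply]
      rfl
    rw [h3, ← Complex.conj_mul']
    ring
  rw [h2, Complex.ofReal_re] at h
  have h4 := nonneg_of_mul_nonneg_right h (by positivity)
  refine (mul_nonneg (by positivity : (0 : ℝ) ≤ ((d : ℝ) + 2 * k) / (d - 1).factorial)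
    h4).trans_eq ?_
  rw [Finset.mul_sum]
  refine Finset.sum_congr rfl fun x _ ↦ ?_
  rw [Finset.mul_sum]
  refine Finset.sum_congr rfl fun y _ ↦ ?_
  rw [eval_jacobiH]
  ring

end Laplacian

/-! ### Moments of designs and orthogonality -/

section Designs

variable {d : ℕ}

/-- Orthogonality of `h_k`, `k ≥ 1`, to the constants in terms of the moments of `α`. -/
theorem sum_jacobiCoeff_mul_moment (hd : 1 ≤ d) {k : ℕ} (hk : 1 ≤ k) :
    ∑ r ∈ Finset.range (k + 1), jacobiCoeff d k r *
      ((k - r + 1).factorial * (d - 1).factorial / (d + (k - r + 1) - 1).factorial : ℝ) = 0 := by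
  -- `P(s) = (s+d+1)⋯(s+d+k-1) = (d+s+k-1)! / (d+s)!` is what remains of each term besides the
  -- signed binomial coefficient and `(d-1)!/k!`.
  set P : ℝ[X] := (ascPochhammer ℝ (k - 1)).comp (X + C ((d : ℝ) + 1))
  have hP : P.natDegree < k := by
    refine (natDegree_comp_le).trans_lt ?_
    rw [ascPochhammer_natDegree, natDegree_X_add_C]
    lia
  have hPs : ∀ s : ℕ, P.eval (s : ℝ) * (d + s).factorial = ((d + s + (k - 1)).factorial : ℝ) := by
    intro s
    have h := Nat.factorial_mul_ascFactorial (d + s) (k - 1)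
    have h2 : P.eval (s : ℝ) = ((d + s + 1).ascFactorial (k - 1) : ℝ) := by
      rw [← ascPochhammer_nat_eq_ascFactorial, ascPochhammer_eval_cast]
      simp only [P, eval_comp, eval_add, eval_X, eval_C]
      push_cast
      ring_nf
    rw [h2, mul_comm]
    exact_mod_cast h
  have h0 := congrFun (Polynomial.fwdDiff_iter_eq_zero_of_degree_lt hP) 0
  rw [fwdDiff_iter_eq_sum_shift] at h0
  rw [← Finset.sum_flip]
  have hfac : ((d - 1).factorial / k.factorial : ℝ) * 0 = 0 := mul_zero _
  rw [← hfac, ← (show _ = (0 : ℝ) from h0), Finset.mul_sum]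
  refine Finset.sum_congr rfl fun s hs ↦ ?_
  have hs' : s ≤ k := Nat.lt_succ_iff.1 (Finset.mem_range.1 hs)
  have h1 : k - (k - s) = s := by lia
  have h2 : d + 2 * k - (k - s) - 1 = d + s + (k - 1) := by lia
  have h3 : d + (s + 1) - 1 = d + s := by lia
  rw [jacobiCoeff, h1, h2, h3, ← hPs s]
  have hch : (k.choose s : ℝ) = k.factorial / (s.factorial * (k - s).factorial) :=
    Nat.cast_choose ℝ hs'
  simp only [zsmul_eq_mul, Int.cast_mul, Int.cast_pow, Int.cast_neg, Int.cast_one,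
    Int.cast_natCast, hch, zero_add, nsmul_eq_mul, mul_one]
  field_simp

/-- For empty `X` the average is `0` by convention, while `normForm d ^ t` has integral `1`. -/
theorem IsDesign.card_ne_zero (hd : 1 ≤ d) {t : ℕ} {X : Finset (Omega d)} (hX : IsDesign t X) :
    (X.card : ℝ) ≠ 0 := by
  have hne : Nonempty (Fin d) := ⟨⟨0, hd⟩⟩
  obtain ⟨x⟩ : Nonempty (Omega d) := (NormedSpace.sphere_nonempty.2 zero_le_one).to_subtype
  have hN := pow_mem_Hom (normForm_mem (d := d)) t
  rw [mul_one] at hN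
  have h := hX _ hN
  have hev : ∀ z : Omega d, evalAt (normForm d ^ t) (z : EuclideanSpace ℂ (Fin d)) = 1 := by
    intro z
    have := evalAt_normForm (z : EuclideanSpace ℂ (Fin d)) (by simp)
    unfold evalAt at this ⊢
    rw [map_pow, this, one_pow]
  have h1 := integral_omega_norm_inner_pow x 0
  simp only [mul_zero, pow_zero, integral_const, smul_eq_mul, mul_one, Nat.factorial_zero,
    Nat.cast_one, one_mul, add_zero] at h1
  rw [div_self (by positivity)] at h1
  simp only [hev, integral_const, h1, one_smul] at h
  intro h0
  have h0' : X.card = 0 := by exact_mod_cast h0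
  rw [h0'] at h
  simp at h

/-- The factor `normForm d ^ (t - n)` lifts the test polynomial to `Hom(t,t)` and equals `1` on the
sphere. -/
theorem IsDesign.sum_norm_inner_pow (hd : 1 ≤ d) {t : ℕ} {X : Finset (Omega d)}
    (hX : IsDesign t X) (x : Omega d) {n : ℕ} (hn : n ≤ t) :
    ∑ y ∈ X, (‖inner ℂ (x : EuclideanSpace ℂ (Fin d)) y‖ ^ 2) ^ n =
      X.card * (n.factorial * (d - 1).factorial / (d + n - 1).factorial) := by
  have hmem := prod_forms_mem (x : EuclideanSpace ℂ (Fin d)) (t - n) n n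
  rw [Nat.sub_add_cancel hn] at hmem
  have h := hX _ hmem
  have hev : ∀ z : Omega d, evalAt (normForm d ^ (t - n) *
      linForm (x : EuclideanSpace ℂ (Fin d)) ^ n * conjLinForm (x : EuclideanSpace ℂ (Fin d)) ^ n)
      (z : EuclideanSpace ℂ (Fin d)) =
      ((‖inner ℂ (x : EuclideanSpace ℂ (Fin d)) z‖ ^ (2 * n) : ℝ) : ℂ) := by
    intro z
    have hN := evalAt_normForm (z : EuclideanSpace ℂ (Fin d)) (by simp)
    have hl := evalAt_linForm (x : EuclideanSpace ℂ (Fin d)) z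
    have hm := evalAt_conjLinForm (x : EuclideanSpace ℂ (Fin d)) z
    unfold evalAt at hN hl hm ⊢
    rw [map_mul, map_mul, map_pow, map_pow, map_pow, hN, hl, hm, one_pow, one_mul, ← mul_pow,
      ← inner_conj_symm (z : EuclideanSpace ℂ (Fin d)) x, Complex.mul_conj', pow_mul]
    push_cast
    rfl
  simp only [hev] at h
  rw [integral_complex_ofReal, integral_omega_norm_inner_pow x n] at h
  have h' : (1 / (X.card : ℝ)) * ∑ y ∈ X, ‖inner ℂ (x : EuclideanSpace ℂ (Fin d)) y‖ ^ (2 * n) =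
      n.factorial * (d - 1).factorial / (d + n - 1).factorial := by
    apply Complex.ofReal_injective
    push_cast at h ⊢
    exact h
  have hc := hX.card_ne_zero hd
  rw [← h']
  simp only [pow_mul]
  field_simp

/-- The extra factor `α` raises the degree to `k + 1`, hence `k < t` is what keeps all moments
within reach of the design. -/
theorem IsDesign.sum_mul_eval_jacobiH_eq_zero (hd : 1 ≤ d) {t : ℕ} {X : Finset (Omega d)}
    (hX : IsDesign t X) {k : ℕ} (hk : 1 ≤ k) (hkt : k < t) (x : Omega d) :
    ∑ y ∈ X, ‖inner ℂ (x : EuclideanSpace ℂ (Fin d)) y‖ ^ 2 *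
      (jacobiH d k).eval (‖inner ℂ (x : EuclideanSpace ℂ (Fin d)) y‖ ^ 2) = 0 := by
  have h1 : ∀ y : Omega d, ‖inner ℂ (x : EuclideanSpace ℂ (Fin d)) y‖ ^ 2 *
      (jacobiH d k).eval (‖inner ℂ (x : EuclideanSpace ℂ (Fin d)) y‖ ^ 2) =
      ∑ r ∈ Finset.range (k + 1), ((d : ℝ) + 2 * k) / (d - 1).factorial * jacobiCoeff d k r *
        (‖inner ℂ (x : EuclideanSpace ℂ (Fin d)) y‖ ^ 2) ^ (k - r + 1) := by
    intro y
    rw [eval_jacobiH, Finset.mul_sum, Finset.mul_sum]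
    refine Finset.sum_congr rfl fun r _ ↦ ?_
    ring
  simp only [h1]
  rw [Finset.sum_comm]
  have h2 : ∀ r ∈ Finset.range (k + 1), ∑ y ∈ X,
      ((d : ℝ) + 2 * k) / (d - 1).factorial * jacobiCoeff d k r *
        (‖inner ℂ (x : EuclideanSpace ℂ (Fin d)) y‖ ^ 2) ^ (k - r + 1) =
      ((d : ℝ) + 2 * k) / (d - 1).factorial * X.card * (jacobiCoeff d k r *
        ((k - r + 1).factorial * (d - 1).factorial / (d + (k - r + 1) - 1).factorial : ℝ)) := by
    intro r _
    rw [← Finset.mul_sum, hX.sum_norm_inner_pow hd x (by lia)]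
    ring
  rw [Finset.sum_congr rfl h2, ← Finset.mul_sum, sum_jacobiCoeff_mul_moment hd hk, mul_zero]

/-- Here `h_0` is the constant `d`, and the first moment is `1/d`. -/
theorem IsDesign.sum_mul_eval_jacobiH_zero (hd : 1 ≤ d) {t : ℕ} {X : Finset (Omega d)}
    (hX : IsDesign t X) (ht : 1 ≤ t) (x : Omega d) :
    ∑ y ∈ X, ‖inner ℂ (x : EuclideanSpace ℂ (Fin d)) y‖ ^ 2 *
      (jacobiH d 0).eval (‖inner ℂ (x : EuclideanSpace ℂ (Fin d)) y‖ ^ 2) = X.card := by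
  have h := hX.sum_norm_inner_pow hd x ht
  simp only [pow_one] at h
  obtain ⟨e, rfl⟩ : ∃ e, d = e + 1 := ⟨d - 1, by lia⟩
  have h0 : ∀ a, (jacobiH (e + 1) 0).eval a = (e + 1 : ℝ) := by
    intro a
    simp [eval_jacobiH, jacobiCoeff]
    field_simp
  simp only [h0]
  rw [← Finset.sum_mul, h]
  simp only [add_tsub_cancel_right, Nat.factorial_succ]
  push_cast
  field_simp
  simp

end Designs

end ComplexDesign
end

/-! ### The linear programming bound -/

theorem mainTheorem2 (d : ℕ) (hd : 1 ≤ d) (t : ℕ)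
    (X : Finset (ComplexDesign.Omega d)) (hX : ComplexDesign.IsDesign t X)
    (F : Polynomial ℝ)
    (hF : ∀ α ∈ ComplexDesign.degreeSet X, 0 ≤ α * F.eval α)
    (hF1 : 0 < F.eval 1)
    (c : ℕ →₀ ℝ)
    (hc : F = c.sum (fun r a => a • ComplexDesign.jacobiH d r))
    (hc0 : 0 < c 0)
    (hct : ∀ r : ℕ, t ≤ r → c r ≤ 0) :
    F.eval 1 / c 0 ≤ (X.card : ℝ) := by
  -- For `t = 0` the two sign conditions on `c 0` contradict each other.
  have ht : 1 ≤ t := by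
    by_contra h
    exact absurd (hct 0 (by lia)) (not_le.2 hc0)
  have hcard : 0 < (X.card : ℝ) := lt_of_le_of_ne (Nat.cast_nonneg _) (hX.card_ne_zero hd).symm
  set T : Polynomial ℝ → ℝ := fun p ↦ ∑ x ∈ X, ∑ y ∈ X,
    ‖inner ℂ (x : EuclideanSpace ℂ (Fin d)) (y : EuclideanSpace ℂ (Fin d))‖ ^ 2 *
      p.eval (‖inner ℂ (x : EuclideanSpace ℂ (Fin d)) (y : EuclideanSpace ℂ (Fin d))‖ ^ 2) with hT
  have hlow : X.card * F.eval 1 ≤ T F := by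
    rw [← nsmul_eq_mul, ← Finset.sum_const]
    refine Finset.sum_le_sum fun x hx ↦ ?_
    have h1 : ‖inner ℂ (x : EuclideanSpace ℂ (Fin d)) (x : EuclideanSpace ℂ (Fin d))‖ ^ 2 = 1 := by
      simp [inner_self_eq_norm_sq_to_K]
    have h2 := Finset.single_le_sum (s := X) (a := x)
      (f := fun y : ComplexDesign.Omega d ↦ ‖inner ℂ (x : EuclideanSpace ℂ (Fin d)) (y : EuclideanSpace ℂ (Fin d))‖ ^ 2 *
        F.eval (‖inner ℂ (x : EuclideanSpace ℂ (Fin d)) (y : EuclideanSpace ℂ (Fin d))‖ ^ 2))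
      (fun y hy ↦ ?_) hx
    · simpa only [h1, one_mul] using h2
    · by_cases hxy : x = y
      · subst hxy
        simpa only [h1, one_mul] using hF1.le
      · exact hF _ ⟨x, hx, y, hy, hxy, rfl⟩
  have hsum : T F = ∑ r ∈ c.support, c r * T (ComplexDesign.jacobiH d r) := by
    simp only [hT, Finset.mul_sum]
    rw [Finset.sum_comm (s := c.support)]
    refine Finset.sum_congr rfl fun x _ ↦ ?_
    rw [Finset.sum_comm]
    refine Finset.sum_congr rfl fun y _ ↦ ?_
    conv_lhs => rw [hc, Finsupp.sum]
    simp only [Polynomial.eval_finsetSum, Polynomial.eval_smul, smul_eq_mul, Finset.mul_sum]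
    refine Finset.sum_congr rfl fun r _ ↦ ?_
    ring
  have hT0 : T (ComplexDesign.jacobiH d 0) = X.card * X.card := by
    simp only [hT, hX.sum_mul_eval_jacobiH_zero hd ht, Finset.sum_const, nsmul_eq_mul]
  -- Below `t` the design kills the terms with `r ≥ 1`; from `t` on, the sign of `c r` meets
  -- positivity of the kernel.
  have hup : T F ≤ c 0 * (X.card * X.card) := by
    rw [hsum, ← hT0, ← Finset.add_sum_erase _ _ (Finsupp.mem_support_iff.2 hc0.ne')]
    refine add_le_of_nonpos_right (Finset.sum_nonpos fun r hr ↦ ?_)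
    have hr0 : 1 ≤ r := Nat.one_le_iff_ne_zero.2 (Finset.ne_of_mem_erase hr)
    rcases lt_or_ge r t with hrt | hrt
    · simp only [hT, hX.sum_mul_eval_jacobiH_eq_zero hd hr0 hrt, Finset.sum_const_zero, mul_zero,
        le_refl]
    · exact mul_nonpos_of_nonpos_of_nonneg (hct r hrt)
        (ComplexDesign.sum_mul_eval_jacobiH_nonneg hd r X)
  rw [div_le_iff₀ hc0]
  have h := hlow.trans hup
  have h' : (X.card : ℝ) * F.eval 1 ≤ X.card * (X.card * c 0) := by linarith
  exact le_of_mul_le_mul_left h' hcard
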